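/- Let $a,b>0$ with $a+b<1$, and let $p_1,p_2,\dots$ be independent random variables on a probability space $(\Omega,\mathcal P)$, each uniformly distributed on $[0,1]$. Starting from $I_\emptyset=[0,1]$, replace each interval $I$ of level $n-1$ by its left child (the left-most closed subinterval of length $a|I|$) and its right child (the right-most closed subinterval of length $b|I|$); the intersection over $n$ of the unions of the level $n$ intervals is the deterministic Moran set $C_{ab}$. Let $\mu_\omega$ be the random Borel probability measure on $C_{ab}$ for which, for every interval $I$ of level $n-1$, the left child of $I$ has measure $p_n(\omega)\mu_\omega(I)$ and the right child has measure $(1-p_n(\omega))\mu_\omega(I)$. A dimension function is a map $\Phi:(0,1)\to[0,\infty)$ such that $t^{1+\Phi(t)}$ decreases to $0$ as $t$ decreases to $0$. It is large if $\Phi(t)=H(t)\frac{\log|\log t|}{|\log t|}$ for all small $t$, with $H(t)\to\infty$ as $t\to0^+$. The upper $\Phi$-dimension of a measure $\mu$ is $$\overline{\dim}_\Phi\mu=\inf\Big\{d:\ (\exists C_1\in(0,1),\,C_2>0)(\forall\, 0<r<R^{1+\Phi(R)}\le R\le C_1)\ \ \tfrac{\mu(B(x,R))}{\mu(B(x,r))}\le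 C_2\big(\tfrac Rr\big)^d\ \ \forall x\in\operatorname{supp}\mu\Big\}.$$ For $\theta\ge0$ let $(Y(\theta),Z(\theta))=(\log p_1,\log a)$ if $p_1\le \frac{a^\theta}{a^\theta+b^\theta}$ and $(Y(\theta),Z(\theta))=(\log(1-p_1),\log b)$ otherwise, and put $G(\theta)=\mathbb E(Y(\theta))/\mathbb E(Z(\theta))$. Then the following hold. 1. For all $\theta\ge0$, $Y(\theta)$ and $Z(\theta)$ are integrable and $$G(\theta)=\frac{a^\theta\log\frac{a^\theta}{a^\theta+b^\theta}-a^\theta+b^\theta\log\frac{b^\theta}{a^\theta+b^\theta}-b^\theta}{a^\theta\log a+b^\theta\log b}.$$ 2. Write $a=b^\gamma$. For $\theta\ge0$, $G(\theta)=\theta$ if and only if $b^\theta+b^{\gamma\theta}=e^{-1}$. This last equation has exactly one real root $\theta=D_{ab}$; it is positive, and almost surely $\overline{\dim}_\Phi\mu_\omega=D_{ab}$ for all large dimension functions $\Phi$. 3. As $(a,b)$ varies over $\{a,b>0,\ a+b<1\}$, $D_{ab}\to0$ as $a$ and $b$ both tend to $0$, and $D_{ab}\to\infty$ as $a\to1$,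 and also as $b\to1$. -/

import Mathlib

open MeasureTheory ProbabilityTheory Filter Topology Set

/-! ### Dimension functions and upper dimensions of measures -/

/-- A dimension function: a map `Φ : (0,1) → [0,∞)` such that `t ^ (1 + Φ t)` decreases to `0`
as `t` decreases to `0`. Values of `Φ` outside `(0,1)` are irrelevant. -/
def IsDimensionFunction (Φ : ℝ → ℝ) : Prop :=
  (∀ t ∈ Ioo (0 : ℝ) 1, 0 ≤ Φ t) ∧
  MonotoneOn (fun t : ℝ => t ^ (1 + Φ t)) (Ioo 0 1) ∧
  Tendsto (fun t : ℝ => t ^ (1 + Φ t)) (𝓝[>] 0) (𝓝 0)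

/-- `Φ` is large: `Φ t = H t * (log |log t| / |log t|)` near `0`, where `H t → ∞` as `t → 0+`. -/
def IsLargeDimensionFunction (Φ : ℝ → ℝ) : Prop :=
  IsDimensionFunction Φ ∧
  ∃ H : ℝ → ℝ, Tendsto H (𝓝[>] 0) atTop ∧
    ∀ᶠ t in 𝓝[>] (0 : ℝ), Φ t = H t * (Real.log |Real.log t| / |Real.log t|)

/-- The upper `Φ`-dimension of a measure `μ` on a metric space, as an extended real number
(the infimum of the empty set is `∞`). -/
noncomputable def upperPhiDim {X : Type*} [PseudoMetricSpace X] [MeasurableSpace X]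
    (Φ : ℝ → ℝ) (μ : Measure X) : EReal :=
  sInf (((↑) : ℝ → EReal) '' {d : ℝ |
    ∃ C₁ C₂ : ℝ, 0 < C₁ ∧ C₁ < 1 ∧ 0 < C₂ ∧
      ∀ r R : ℝ, 0 < r → r < R ^ (1 + Φ R) → R ^ (1 + Φ R) ≤ R → R ≤ C₁ →
        ∀ x ∈ μ.support,
          μ (Metric.ball x R) / μ (Metric.ball x r) ≤ ENNReal.ofReal (C₂ * (R / r) ^ d)})

/-! ### Moran sets and Moran measures on the line

A path in the binary tree is a sequence `v : ℕ → Bool`; `v n = false` selects the left child and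
`v n = true` the right child when passing from level `n` to level `n + 1`. The ratios and the
probability used in that passage are `a n`, `b n` and `p n`. -/

/-- Left endpoint and length of the level `n` Moran interval along the path `v`. -/
noncomputable def moranInterval (a b : ℕ → ℝ) (v : ℕ → Bool) : ℕ → ℝ × ℝ
  | 0 => (0, 1)
  | n + 1 =>
    if v n then
      ((moranInterval a b v n).1 + (moranInterval a b v n).2 - b n * (moranInterval a b v n).2,
        b n * (moranInterval a b v n).2)
    else
      ((moranInterval a b v n).1, a n * (moranInterval a b v n).2)

/-- The level `n` Moran interval along the path `v`, as a closed interval. -/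
def moranCell (a b : ℕ → ℝ) (v : ℕ → Bool) (n : ℕ) : Set ℝ :=
  Icc (moranInterval a b v n).1 ((moranInterval a b v n).1 + (moranInterval a b v n).2)

/-- The point of the Moran set coded by the path `v`: the limit of the (nondecreasing) left
endpoints of the Moran intervals along `v`. -/
noncomputable def moranPoint (a b : ℕ → ℝ) (v : ℕ → Bool) : ℝ :=
  ⨆ n, (moranInterval a b v n).1

/-- The Moran measure with ratios `a n`, `b n` and probabilities `p n`: at level `n + 1` the left
child receives the proportion `p n` of the mass of its parent and the right child the proportion
`1 - p n`. It is the image under the coding map of the product of the measures on `Bool` that give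
mass `p n` to `false` and `1 - p n` to `true`. -/
noncomputable def moranMeasure (a b : ℕ → ℝ) (p : ℕ → unitInterval) : Measure ℝ :=
  (Measure.infinitePi fun n => bernoulliMeasure false true (p n)).map (moranPoint a b)

/-! ### The functions `Y`, `Z` and `G` -/

/-- The value of `Y(θ)` when the ratios are `a`, `b` and the probability is `p`. -/
noncomputable def branchLogProb (a b p θ : ℝ) : ℝ :=
  if p ≤ a ^ θ / (a ^ θ + b ^ θ) then Real.log p else Real.log (1 - p)

/-- The value of `Z(θ)` when the ratios are `a`, `b` and the probability is `p`. -/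
noncomputable def branchLogRatio (a b p θ : ℝ) : ℝ :=
  if p ≤ a ^ θ / (a ^ θ + b ^ θ) then Real.log a else Real.log b

/-- `G(θ) = E[Y(θ)] / E[Z(θ)]`. -/
noncomputable def branchG {Ω : Type*} [MeasurableSpace Ω] (P : Measure Ω) (a b p : Ω → ℝ)
    (θ : ℝ) : ℝ :=
  (∫ ω, branchLogProb (a ω) (b ω) (p ω) θ ∂P) / ∫ ω, branchLogRatio (a ω) (b ω) (p ω) θ ∂P

/-! ### The Moran measure has the prescribed masses -/

lemma moranInterval_congr (a b : ℕ → ℝ) {v w : ℕ → Bool} {n : ℕ} (h : ∀ i < n, v i = w i) :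
    moranInterval a b v n = moranInterval a b w n := by
  induction n with
  | zero => rfl
  | succ n ih =>
    simp only [moranInterval, ih fun i hi => h i (by omega), h n (by omega)]

lemma moranInterval_bounds {a b : ℕ → ℝ} (ha : ∀ n, 0 < a n) (hb : ∀ n, 0 < b n)
    (hab : ∀ n, a n + b n < 1) (v : ℕ → Bool) (n : ℕ) :
    0 < (moranInterval a b v n).2 ∧
    (moranInterval a b v n).1 ≤ (moranInterval a b v (n + 1)).1 ∧
    (moranInterval a b v (n + 1)).1 + (moranInterval a b v (n + 1)).2 ≤
      (moranInterval a b v n).1 + (moranInterval a b v n).2 := by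
  have hpos : ∀ n, 0 < (moranInterval a b v n).2 := by
    intro n
    induction n with
    | zero => simp [moranInterval]
    | succ n ih =>
      have := mul_pos (ha n) ih
      have := mul_pos (hb n) ih
      by_cases h : v n <;> simpa [moranInterval, h]
  have h0 := hpos n
  have h1 := mul_pos (ha n) h0
  have h2 := mul_pos (hb n) h0
  have h3 := mul_lt_mul_of_pos_right (hab n) h0
  refine ⟨h0, ?_⟩
  by_cases h : v n <;> simp only [moranInterval, h] <;> constructor <;> simp <;> nlinarith

lemma moranPoint_mem {a b : ℕ → ℝ} (ha : ∀ n, 0 < a n) (hb : ∀ n, 0 < b n)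
    (hab : ∀ n, a n + b n < 1) (v : ℕ → Bool) (n : ℕ) :
    moranPoint a b v ∈ moranCell a b v n := by
  have hB := moranInterval_bounds ha hb hab v
  have hmono : Monotone fun n => (moranInterval a b v n).1 :=
    monotone_nat_of_le_succ fun n => (hB n).2.1
  have hanti : Antitone fun n => (moranInterval a b v n).1 + (moranInterval a b v n).2 :=
    antitone_nat_of_succ_le fun n => (hB n).2.2
  have hle : ∀ m, (moranInterval a b v m).1 ≤
      (moranInterval a b v n).1 + (moranInterval a b v n).2 := by
    intro m
    have h1 : (moranInterval a b v m).1 ≤ (moranInterval a b v (max m n)).1 :=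
      hmono (le_max_left m n)
    have h2 : (moranInterval a b v (max m n)).1 + (moranInterval a b v (max m n)).2 ≤
      (moranInterval a b v n).1 + (moranInterval a b v n).2 := hanti (le_max_right m n)
    linarith [(hB (max m n)).1]
  exact ⟨le_ciSup (f := fun m => (moranInterval a b v m).1) ⟨_, forall_mem_range.2 hle⟩ n,
    ciSup_le hle⟩

lemma moranPoint_mem_iff {a b : ℕ → ℝ} (ha : ∀ n, 0 < a n) (hb : ∀ n, 0 < b n)
    (hab : ∀ n, a n + b n < 1) (v w : ℕ → Bool) (n : ℕ) :
    moranPoint a b w ∈ moranCell a b v n ↔ ∀ i < n, w i = v i := by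
  constructor
  · induction n with
    | zero => simp
    | succ n ih =>
      intro h
      have hB := moranInterval_bounds ha hb hab v n
      have hprev : ∀ i < n, w i = v i := ih ⟨hB.2.1.trans h.1, h.2.trans hB.2.2⟩
      have hw := moranPoint_mem ha hb hab w (n + 1)
      have heq := moranInterval_congr a b hprev
      have h3 : a n * (moranInterval a b v n).2 + b n * (moranInterval a b v n).2 <
          (moranInterval a b v n).2 := by nlinarith [mul_lt_mul_of_pos_right (hab n) hB.1]
      clear ih hab
      intro i hi
      rcases Nat.lt_succ_iff_lt_or_eq.1 hi with hi | rfl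
      · exact hprev i hi
      · unfold moranCell at h hw
        by_contra hne
        cases hv : v i <;> cases hw' : w i <;>
          simp [moranInterval, heq, hv, hw'] at h hw hne <;> linarith [h.1, h.2, hw.1, hw.2]
  · intro h
    have := moranPoint_mem ha hb hab w n
    rwa [moranCell, moranInterval_congr a b h] at this

lemma measurable_moranPoint (a b : ℕ → ℝ) : Measurable (moranPoint a b) := by
  refine Measurable.iSup fun n => ?_
  suffices h : Measurable fun v => moranInterval a b v n from h.fst
  induction n with
  | zero => exact measurable_const
  | succ n ih =>
    simp only [moranInterval]
    refine Measurable.ite (measurableSet_eq_fun (measurable_pi_apply n) measurable_const) ?_ ?_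
    · fun_prop
    · fun_prop

/-- The Moran measure gives every Moran interval the product of the probabilities along the path
that leads to it; in particular `[0,1]` has mass `1`. -/
lemma moranMeasure_moranCell {a b : ℕ → ℝ} (ha : ∀ n, 0 < a n) (hb : ∀ n, 0 < b n)
    (hab : ∀ n, a n + b n < 1) (p : ℕ → unitInterval) (v : ℕ → Bool) (n : ℕ) :
    moranMeasure a b p (moranCell a b v n) =
      ∏ i ∈ Finset.range n, ENNReal.ofReal (if v i then 1 - (p i : ℝ) else p i) := by
  rw [moranMeasure, Measure.map_apply (measurable_moranPoint a b) (by exact measurableSet_Icc)]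
  have : moranPoint a b ⁻¹' moranCell a b v n =
      Set.pi (Finset.range n : Set ℕ) fun i => {v i} := by
    ext w
    simp [moranPoint_mem_iff ha hb hab]
  rw [this, Measure.infinitePi_pi _ fun _ _ => measurableSet_singleton _]
  refine Finset.prod_congr rfl fun i _ => ?_
  classical
  rw [bernoulliMeasure_apply _ (measurableSet_singleton _)]
  have h1 : ENNReal.ofReal (p i) = (unitInterval.toNNReal (p i) : ENNReal) := by
    rw [ENNReal.ofReal, Real.toNNReal_of_nonneg (p i).2.1]; rfl
  have h2 : ENNReal.ofReal (1 - p i) =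
      (unitInterval.toNNReal (unitInterval.symm (p i)) : ENNReal) := by
    rw [ENNReal.ofReal, Real.toNNReal_of_nonneg (sub_nonneg.2 (p i).2.2)]; rfl
  cases v i <;> simp [h1, h2]

/-! Write `M_n = max (a^d / p_n) (b^d / (1 - p_n))`, which is `maxBranch`. Along any path, (ratio of
the lengths of two nested intervals)^d is at most (conditional mass of the inner one) times the
product of the `M_i` over the levels between them, with equality if the path always takes the branch
attaining the maximum. Thus the upper dimension at exponent `d` is governed by products of the
i.i.d. variables `M_i` over windows of consecutive levels. By `log_maxBranch`, `log M = d Z(d) -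
Y(d)`, and its mean is `log (a^d + b^d) + 1`. This changes sign exactly where `a^d + b^d = e⁻¹`,
which is also the equation `G(d) = d`; the left side is strictly decreasing, so the root `D` is
unique.

Upper bound, `d > D`: `E (M^s) = (a^d + b^d)^s / (1 - s)` is below `1` for a suitable `s` in
`(0,1)`. Markov's inequality makes a window of length `k` bad with exponentially small probability,
and Borel–Cantelli shows that almost surely all windows of length at least `A log (n + 1)` starting
at a late level `n` have product at most `1` (`ae_eventually_prod_maxBranch_le_one`). Largeness of
`Φ` makes every pair of radii in the definition span such a window
(`IsLargeDimensionFunction.eventually_levels`).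

Lower bound, `d < D`: by the strong law, the product over the first `n` levels tends to infinity.
With `R` fixed and `r → 0`, balls around the point coded by the maximizing path violate every bound
of exponent less than `d`. -/

/-- The larger of the ratios `a ^ d / x` and `b ^ d / (1 - x)` of the `d`-th powers of the contraction ratios
to the probabilities of the two branches. -/
noncomputable def maxBranch (a b d x : ℝ) : ℝ := max (a ^ d / x) (b ^ d / (1 - x))

/-- The cut that defines `Y` and `Z` is exactly the point `x` at which the two ratios coincide. -/
lemma maxBranch_eq_ite {a b d x : ℝ} (ha : 0 < a) (hb : 0 < b) (hx : x ∈ Ioo (0 : ℝ) 1) :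
    maxBranch a b d x =
      if x ≤ a ^ d / (a ^ d + b ^ d) then a ^ d / x else b ^ d / (1 - x) := by
  have hA := Real.rpow_pos_of_pos ha d
  have hB := Real.rpow_pos_of_pos hb d
  have h1 : 0 < 1 - x := by linarith [hx.2]
  unfold maxBranch
  split_ifs with h
  · rw [le_div_iff₀ (by positivity)] at h
    refine max_eq_left ?_
    rw [div_le_div_iff₀ h1 hx.1]
    nlinarith
  · rw [not_le, div_lt_iff₀ (by positivity)] at h
    refine max_eq_right ?_
    rw [div_le_div_iff₀ hx.1 h1]
    nlinarith

lemma maxBranch_pos {a b d x : ℝ} (ha : 0 < a) (hx : x ∈ Ioo (0 : ℝ) 1) :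
    0 < maxBranch a b d x :=
  lt_max_of_lt_left (div_pos (Real.rpow_pos_of_pos ha d) hx.1)

lemma log_maxBranch {a b d x : ℝ} (ha : 0 < a) (hb : 0 < b) (hx : x ∈ Ioo (0 : ℝ) 1) :
    Real.log (maxBranch a b d x) = d * branchLogRatio a b x d - branchLogProb a b x d := by
  have hA := Real.rpow_pos_of_pos ha d
  have hB := Real.rpow_pos_of_pos hb d
  have h1 : 0 < 1 - x := by linarith [hx.2]
  rw [maxBranch_eq_ite ha hb hx, branchLogRatio, branchLogProb]
  split_ifs with h
  · rw [Real.log_div hA.ne' hx.1.ne', Real.log_rpow ha]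
  · rw [Real.log_div hB.ne' h1.ne', Real.log_rpow hb]

lemma measurable_maxBranch (a b d : ℝ) : Measurable (maxBranch a b d) := by
  unfold maxBranch
  fun_prop

/-! ### Integrals over the unit interval of functions defined by cases -/

lemma intervalIntegral_ite_le {f g : ℝ → ℝ} {q : ℝ} (h0 : 0 ≤ q) (h1 : q ≤ 1)
    (hf : IntervalIntegrable f volume 0 q) (hg : IntervalIntegrable g volume q 1) :
    IntervalIntegrable (fun x => if x ≤ q then f x else g x) volume 0 1 ∧
    ∫ x in (0 : ℝ)..1, (if x ≤ q then f x else g x) =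
      (∫ x in (0 : ℝ)..q, f x) + ∫ x in q..1, g x := by
  have e1 : EqOn f (fun x => if x ≤ q then f x else g x) (uIoc 0 q) := fun x hx => by
    rw [uIoc_of_le h0] at hx
    simp [hx.2]
  have e2 : EqOn g (fun x => if x ≤ q then f x else g x) (uIoc q 1) := fun x hx => by
    rw [uIoc_of_le h1] at hx
    simp [hx.1]
  have i1 := hf.congr e1
  have i2 := hg.congr e2
  refine ⟨i1.trans i2, ?_⟩
  rw [← intervalIntegral.integral_add_adjacent_intervals i1 i2]
  congr 1
  · exact (intervalIntegral.integral_congr_ae (.of_forall e1)).symm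
  · exact (intervalIntegral.integral_congr_ae (.of_forall e2)).symm

lemma intervalIntegral_branchLogProb {a b : ℝ} (ha : 0 < a) (hb : 0 < b) (θ : ℝ) :
    IntervalIntegrable (fun x => branchLogProb a b x θ) volume 0 1 ∧
    ∫ x in (0 : ℝ)..1, branchLogProb a b x θ =
      a ^ θ / (a ^ θ + b ^ θ) * Real.log (a ^ θ / (a ^ θ + b ^ θ))
        + b ^ θ / (a ^ θ + b ^ θ) * Real.log (b ^ θ / (a ^ θ + b ^ θ)) - 1 := by
  have hA := Real.rpow_pos_of_pos ha θ
  have hB := Real.rpow_pos_of_pos hb θ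
  have hq : 1 - a ^ θ / (a ^ θ + b ^ θ) = b ^ θ / (a ^ θ + b ^ θ) := by field_simp; ring
  have hq0 : 0 ≤ a ^ θ / (a ^ θ + b ^ θ) := by positivity
  have hq1 : 0 ≤ b ^ θ / (a ^ θ + b ^ θ) := by positivity
  have hg : IntervalIntegrable (fun x => Real.log (1 - x)) volume (a ^ θ / (a ^ θ + b ^ θ)) 1 := by
    have := (intervalIntegral.intervalIntegrable_log' (a := b ^ θ / (a ^ θ + b ^ θ))
      (b := 0)).comp_sub_left 1
    rwa [← hq, sub_sub_cancel, sub_zero] at this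
  have := intervalIntegral_ite_le hq0 (by linarith) intervalIntegral.intervalIntegrable_log' hg
  refine ⟨this.1, this.2.trans ?_⟩
  rw [intervalIntegral.integral_comp_sub_left (fun x => Real.log x) 1, integral_log, integral_log,
    hq]
  have : a ^ θ / (a ^ θ + b ^ θ) = 1 - b ^ θ / (a ^ θ + b ^ θ) := by linarith
  simp
  linarith

lemma intervalIntegral_branchLogRatio {a b : ℝ} (ha : 0 < a) (hb : 0 < b) (θ : ℝ) :
    IntervalIntegrable (fun x => branchLogRatio a b x θ) volume 0 1 ∧
    ∫ x in (0 : ℝ)..1, branchLogRatio a b x θ =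
      a ^ θ / (a ^ θ + b ^ θ) * Real.log a + b ^ θ / (a ^ θ + b ^ θ) * Real.log b := by
  have hA := Real.rpow_pos_of_pos ha θ
  have hB := Real.rpow_pos_of_pos hb θ
  have hq : 1 - a ^ θ / (a ^ θ + b ^ θ) = b ^ θ / (a ^ θ + b ^ θ) := by field_simp; ring
  have hq0 : 0 ≤ a ^ θ / (a ^ θ + b ^ θ) := by positivity
  have hq1 : 0 ≤ b ^ θ / (a ^ θ + b ^ θ) := by positivity
  have := intervalIntegral_ite_le (f := fun _ => Real.log a) (g := fun _ => Real.log b)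
    hq0 (by linarith) intervalIntegrable_const intervalIntegrable_const
  refine ⟨this.1, this.2.trans ?_⟩
  rw [intervalIntegral.integral_const, intervalIntegral.integral_const, hq, sub_zero]
  simp

/-- With `A = a^d`, `B = b^d`, each branch is a pure power, singular at one endpoint and integrable
there because `s < 1`. The two pieces contribute `A (A + B)^(s-1) / (1 - s)` and `B (A + B)^(s-1) /
(1 - s)`. -/
lemma intervalIntegral_maxBranch_rpow {a b d s : ℝ} (ha : 0 < a) (hb : 0 < b) (hs : s < 1) :
    IntervalIntegrable (fun x => maxBranch a b d x ^ s) volume 0 1 ∧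
    ∫ x in (0 : ℝ)..1, maxBranch a b d x ^ s = (a ^ d + b ^ d) ^ s / (1 - s) := by
  have hA := Real.rpow_pos_of_pos ha d
  have hB := Real.rpow_pos_of_pos hb d
  set A := a ^ d with hAdef
  set B := b ^ d with hBdef
  have hS : 0 < A + B := by positivity
  have hs' : 0 < 1 - s := by linarith
  have hq : 1 - A / (A + B) = B / (A + B) := by field_simp; ring
  have hq0 : 0 ≤ A / (A + B) := by positivity
  have hq1 : 0 ≤ B / (A + B) := by positivity
  have hg : IntervalIntegrable (fun x => B ^ s * (1 - x) ^ (-s)) volume (A / (A + B)) 1 := by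
    have := (intervalIntegral.intervalIntegrable_rpow' (a := B / (A + B))
      (b := 0) (r := -s) (by linarith)).comp_sub_left 1
    rw [← hq, sub_sub_cancel, sub_zero] at this
    exact this.const_mul _
  have key := intervalIntegral_ite_le hq0 (by linarith)
    ((intervalIntegral.intervalIntegrable_rpow' (r := -s) (by linarith)).const_mul (A ^ s)) hg
  have e : ∀ᵐ x ∂(volume.restrict (uIoc (0 : ℝ) 1)), (if x ≤ A / (A + B) then A ^ s * x ^ (-s)
      else B ^ s * (1 - x) ^ (-s)) = maxBranch a b d x ^ s := by
    rw [uIoc_of_le zero_le_one, ← restrict_Ioo_eq_restrict_Ioc]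
    filter_upwards [ae_restrict_mem measurableSet_Ioo] with x hx
    have h1 : 0 < 1 - x := by linarith [hx.2]
    rw [maxBranch_eq_ite ha hb hx, ← hAdef, ← hBdef]
    split_ifs
    · rw [Real.div_rpow hA.le hx.1.le, Real.rpow_neg hx.1.le, div_eq_mul_inv]
    · rw [Real.div_rpow hB.le h1.le, Real.rpow_neg h1.le, div_eq_mul_inv]
  refine ⟨key.1.congr_ae e, ?_⟩
  rw [← intervalIntegral.integral_congr_ae_restrict e, key.2, intervalIntegral.integral_const_mul,
    intervalIntegral.integral_const_mul,
    intervalIntegral.integral_comp_sub_left (fun x => x ^ (-s)) 1,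
    integral_rpow (Or.inl (by linarith)), integral_rpow (Or.inl (by linarith)), hq, sub_self,
    Real.zero_rpow (by linarith), sub_zero, sub_zero, Real.div_rpow hA.le hS.le,
    Real.div_rpow hB.le hS.le]
  have e1 : ∀ x : ℝ, 0 < x → x ^ s * x ^ (1 - s) = x := fun x hx => by
    rw [← Real.rpow_add hx]; simp
  have e2 : (A + B) ^ s = (A + B) / (A + B) ^ (1 - s) := by
    rw [eq_div_iff (Real.rpow_pos_of_pos hS _).ne', e1 _ hS]
  have := (Real.rpow_pos_of_pos hS (1 - s)).ne'
  rw [e2, show -s + 1 = 1 - s by ring]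
  field_simp
  rw [e1 A hA, e1 B hB]

/-! ### Sequences of independent uniform variables -/

section Uniform

variable {Ω : Type*} [MeasurableSpace Ω] {P : Measure Ω}

lemma integral_comp_of_isUniform {u : Ω → unitInterval} (hu : Measurable u)
    (hunif : pdf.IsUniform (fun ω => (u ω : ℝ)) (Icc (0 : ℝ) 1) P) {f : ℝ → ℝ}
    (hf : Measurable f) (hfi : IntervalIntegrable f volume 0 1) :
    Integrable (fun ω => f (u ω)) P ∧ ∫ ω, f (u ω) ∂P = ∫ x in (0 : ℝ)..1, f x := by
  have hm : Measurable (fun ω => (u ω : ℝ)) := hu.subtype_val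
  have hmap : P.map (fun ω => (u ω : ℝ)) = volume.restrict (Icc (0 : ℝ) 1) := by
    rw [hunif, ProbabilityTheory.cond]; simp
  rw [intervalIntegrable_iff_integrableOn_Icc_of_le zero_le_one, IntegrableOn, ← hmap] at hfi
  refine ⟨hfi.comp_measurable hm, ?_⟩
  rw [intervalIntegral.integral_of_le zero_le_one, ← integral_Icc_eq_integral_Ioc, ← hmap,
    integral_map hm.aemeasurable hf.aestronglyMeasurable]

lemma ae_mem_Ioo_of_isUniform {u : Ω → unitInterval} (hu : Measurable u)
    (hunif : pdf.IsUniform (fun ω => (u ω : ℝ)) (Icc (0 : ℝ) 1) P) :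
    ∀ᵐ ω ∂P, (u ω : ℝ) ∈ Ioo (0 : ℝ) 1 := by
  have hm : Measurable (fun ω => (u ω : ℝ)) := hu.subtype_val
  have hmap : P.map (fun ω => (u ω : ℝ)) = volume.restrict (Ioo (0 : ℝ) 1) := by
    rw [hunif, ProbabilityTheory.cond, restrict_Ioo_eq_restrict_Ioc, restrict_Ioc_eq_restrict_Icc]
    simp
  refine ae_of_ae_map (p := fun x => x ∈ Ioo (0 : ℝ) 1) hm.aemeasurable ?_
  rw [hmap]
  exact ae_restrict_mem measurableSet_Ioo

lemma measurable_branchLogProb (a b θ : ℝ) : Measurable (fun x => branchLogProb a b x θ) :=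
  Measurable.ite measurableSet_Iic Real.measurable_log
    (Real.measurable_log.comp (measurable_const.sub measurable_id))

lemma measurable_branchLogRatio (a b θ : ℝ) : Measurable (fun x => branchLogRatio a b x θ) :=
  Measurable.ite measurableSet_Iic measurable_const measurable_const

/-- The witness `s = 1 + 1 / log S` minimizes `S^s / (1 - s)`. With `u = -log S > 1` the minimum is
`u e^(1-u)`, which is below `1` by `u < e^(u-1)`; the condition `u > 1` is also what makes `s`
positive. -/
lemma lt_one_of_rpow_sum {S : ℝ} (h0 : 0 < S) (h1 : S < Real.exp (-1)) :
    ∃ s < 1, 0 < s ∧ S ^ s / (1 - s) < 1 := by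
  have hL : Real.log S < -1 := by rwa [Real.log_lt_iff_lt_exp h0]
  have hne : Real.log S ≠ 0 := by linarith
  have h2 : (Real.log S)⁻¹ < 0 := inv_lt_zero.2 (by linarith)
  have h3 : -1 < (Real.log S)⁻¹ := by
    rw [lt_inv_of_neg (by norm_num) (by linarith)]; simpa using hL
  refine ⟨1 + (Real.log S)⁻¹, by linarith, by linarith, ?_⟩
  have e : (1 - (1 + (Real.log S)⁻¹)) = (-Real.log S)⁻¹ := by rw [inv_neg]; ring
  rw [e, div_inv_eq_mul, Real.rpow_def_of_pos h0, mul_add, mul_inv_cancel₀ hne, mul_one]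
  have h4 := Real.add_one_lt_exp (x := -Real.log S - 1) (by linarith)
  have h5 := Real.exp_pos (Real.log S + 1)
  calc Real.exp (Real.log S + 1) * -Real.log S
      < Real.exp (Real.log S + 1) * Real.exp (-Real.log S - 1) := by
        apply mul_lt_mul_of_pos_left _ h5; linarith
    _ = 1 := by rw [← Real.exp_add]; simp

variable {p : ℕ → Ω → unitInterval}

/-- Markov's inequality for the product of the `s`-th powers, whose mean factors by independence. -/
lemma measure_one_le_prod_maxBranch (hp : ∀ n, Measurable (p n))
    (hunif : ∀ n, pdf.IsUniform (fun ω => (p n ω : ℝ)) (Icc (0 : ℝ) 1) P)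
    (hindep : iIndepFun p P)
    {a b d s : ℝ} (ha : 0 < a) (hb : 0 < b) (hs : s < 1)
    (n k : ℕ) :
    P {ω | 1 ≤ ∏ i ∈ Finset.range k, ENNReal.ofReal (maxBranch a b d (p (n + i) ω) ^ s)} ≤
      ENNReal.ofReal ((a ^ d + b ^ d) ^ s / (1 - s)) ^ k := by
  set f : unitInterval → ENNReal := fun x => ENNReal.ofReal (maxBranch a b d x ^ s) with hf
  have hfm' : Measurable (fun x : ℝ => maxBranch a b d x ^ s) :=
    (measurable_maxBranch a b d).pow_const s
  have hfm : Measurable f := (hfm'.comp measurable_subtype_coe).ennreal_ofReal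
  have hind : iIndepFun (fun i => f ∘ p i) P := hindep.comp (fun _ => f) fun _ => hfm
  have hmean : ∀ i, ∫⁻ ω, f (p i ω) ∂P = ENNReal.ofReal ((a ^ d + b ^ d) ^ s / (1 - s)) := by
    intro i
    have h1 := intervalIntegral_maxBranch_rpow (d := d) ha hb hs
    have h2 := integral_comp_of_isUniform (hp i) (hunif i) hfm' h1.1
    rw [hf, ← ofReal_integral_eq_lintegral_ofReal h2.1, h2.2, h1.2]
    filter_upwards [ae_mem_Ioo_of_isUniform (hp i) (hunif i)] with ω hω
    exact Real.rpow_nonneg (maxBranch_pos ha hω).le _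
  have hind' : iIndepFun (fun i => f ∘ p (n + i)) P :=
    hind.precomp (g := fun i => n + i) (add_right_injective n)
  have hm := fun i => hfm.comp (hp (n + i))
  have := lintegral_prod_eq_prod_lintegral_of_indepFun (Finset.range k) _ hind' hm
  simp only [Function.comp_apply, hmean, Finset.prod_const, Finset.card_range] at this
  have h3 := mul_meas_ge_le_lintegral (μ := P)
    (Finset.measurable_fun_prod (Finset.range k) fun i _ => hm i) 1
  simp only [Function.comp_apply, one_mul, this] at h3
  exact h3

lemma ae_eventually_prod_maxBranch_le_one (hp : ∀ n, Measurable (p n))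
    (hunif : ∀ n, pdf.IsUniform (fun ω => (p n ω : ℝ)) (Icc (0 : ℝ) 1) P)
    (hindep : iIndepFun p P)
    {a b d : ℝ} (ha : 0 < a) (hb : 0 < b)
    (hS : a ^ d + b ^ d < Real.exp (-1)) :
    ∃ A > 0, ∀ᵐ ω ∂P, ∃ N : ℕ, ∀ n ≥ N, ∀ k : ℕ, A * Real.log (n + 1) ≤ k →
      ∏ i ∈ Finset.range k, maxBranch a b d (p (n + i) ω) ≤ 1 := by
  have hA := Real.rpow_pos_of_pos ha d
  have hB := Real.rpow_pos_of_pos hb d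
  obtain ⟨s, hs1, hs0, hρ⟩ := lt_one_of_rpow_sum (add_pos hA hB) hS
  set ρ := (a ^ d + b ^ d) ^ s / (1 - s) with hρdef
  have hρ0 : 0 < ρ := div_pos (Real.rpow_pos_of_pos (add_pos hA hB) _) (by linarith)
  -- Write `ρ^k = σ^k σ^k`. For `k ≥ A log (n + 1)`, with `A = 2 / (-log σ)`, one factor is at most
  -- `(n + 1)^(-2)`; the other is summable over `k`.
  set σ := √ρ with hσ
  have hσ0 : 0 < σ := Real.sqrt_pos.2 hρ0
  have hσ1 : σ < 1 := by rw [hσ, Real.sqrt_lt' one_pos]; simpa using hρ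
  have hσρ : σ * σ = ρ := Real.mul_self_sqrt hρ0.le
  have hlog : Real.log σ < 0 := Real.log_neg hσ0 hσ1
  refine ⟨2 / -Real.log σ, div_pos two_pos (by linarith), ?_⟩
  set A := 2 / -Real.log σ with hAd
  set E : ℕ × ℕ → Set Ω := fun q => {ω | A * Real.log (q.1 + 1) ≤ q.2 ∧
    1 ≤ ∏ i ∈ Finset.range q.2, ENNReal.ofReal (maxBranch a b d (p (q.1 + i) ω) ^ s)} with hE
  have hEle : ∀ q, P (E q) ≤ ENNReal.ofReal (((q.1 : ℝ) + 1) ^ (-2 : ℝ) * σ ^ q.2) := by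
    rintro ⟨n, k⟩
    by_cases h : A * Real.log (n + 1) ≤ k
    · refine (measure_mono fun ω hω => hω.2).trans
        ((measure_one_le_prod_maxBranch hp hunif hindep ha hb hs1 n k).trans ?_)
      rw [← hρdef, ← ENNReal.ofReal_pow hρ0.le]
      refine ENNReal.ofReal_le_ofReal ?_
      rw [← hσρ, mul_pow]
      refine mul_le_mul_of_nonneg_right ?_ (by positivity)
      have hn : (0 : ℝ) < n + 1 := by positivity
      rw [← Real.rpow_natCast, Real.rpow_def_of_pos hσ0, Real.rpow_def_of_pos hn]
      refine Real.exp_le_exp.2 ?_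
      have : A * Real.log (n + 1) * Real.log σ = -2 * Real.log (n + 1) := by
        rw [hAd]; field_simp [hlog.ne]
      nlinarith
    · have : E (n, k) = ∅ := by
        ext ω; simp [hE, h]
      simp [this]
  have hsum : Summable fun q : ℕ × ℕ => ((q.1 : ℝ) + 1) ^ (-2 : ℝ) * σ ^ q.2 := by
    have h1 : Summable fun n : ℕ => ((n : ℝ) + 1) ^ (-2 : ℝ) := by
      have := (summable_nat_add_iff (f := fun n : ℕ => (n : ℝ) ^ (-2 : ℝ)) 1).2
        (Real.summable_nat_rpow.2 (by norm_num))
      simpa using this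
    exact h1.mul_of_nonneg (summable_geometric_of_lt_one hσ0.le hσ1)
      (fun n => by positivity) (fun n => by positivity)
  have htsum : ∑' q, P (E q) ≠ ⊤ :=
    ne_top_of_le_ne_top hsum.tsum_ofReal_ne_top (ENNReal.tsum_le_tsum hEle)
  filter_upwards [ae_finite_setOfPred_mem htsum,
    ae_all_iff.2 fun n => ae_mem_Ioo_of_isUniform (hp n) (hunif n)] with ω hfin hω
  -- Only finitely many windows `(n, k)` are bad, so their starting levels are bounded.
  obtain ⟨N, hN⟩ := (hfin.image Prod.fst).bddAbove
  refine ⟨N + 1, fun n hn k hk => ?_⟩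
  by_contra! hlt
  have hmem : n ∈ Prod.fst '' {q | ω ∈ E q} := by
    refine ⟨(n, k), ⟨hk, ?_⟩, rfl⟩
    have hpos : ∀ i, 0 < maxBranch a b d (p (n + i) ω) := fun i => maxBranch_pos ha (hω _)
    rw [← ENNReal.ofReal_prod_of_nonneg fun i _ => Real.rpow_nonneg (hpos i).le _,
      Real.finsetProd_rpow _ _ fun i _ => (hpos i).le, ← ENNReal.ofReal_one]
    exact ENNReal.ofReal_le_ofReal (Real.one_le_rpow hlt.le hs0.le)
  have := hN hmem
  omega

/-- The strong law applied to `log M`, whose mean `log (a^d + b^d) + 1` is positive here. -/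
lemma ae_tendsto_prod_maxBranch_atTop (hp : ∀ n, Measurable (p n))
    (hunif : ∀ n, pdf.IsUniform (fun ω => (p n ω : ℝ)) (Icc (0 : ℝ) 1) P)
    (hindep : iIndepFun p P)
    {a b d : ℝ} (ha : 0 < a) (hb : 0 < b)
    (hS : Real.exp (-1) < a ^ d + b ^ d) :
    ∀ᵐ ω ∂P, Tendsto (fun n => ∏ i ∈ Finset.range n, maxBranch a b d (p i ω)) atTop atTop := by
  have hA := Real.rpow_pos_of_pos ha d
  have hB := Real.rpow_pos_of_pos hb d
  set f : ℝ → ℝ := fun x => d * branchLogRatio a b x d - branchLogProb a b x d with hf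
  have hfm : Measurable f :=
    ((measurable_branchLogRatio a b d).const_mul d).sub (measurable_branchLogProb a b d)
  have hZ := intervalIntegral_branchLogRatio ha hb d
  have hY := intervalIntegral_branchLogProb ha hb d
  have hfi : IntervalIntegrable f volume 0 1 := (hZ.1.const_mul d).sub hY.1
  have hfint : ∫ x in (0 : ℝ)..1, f x = Real.log (a ^ d + b ^ d) + 1 := by
    rw [hf, intervalIntegral.integral_sub (hZ.1.const_mul d) hY.1,
      intervalIntegral.integral_const_mul, hZ.2, hY.2, Real.log_div hA.ne' (by positivity),
      Real.log_div hB.ne' (by positivity), Real.log_rpow ha, Real.log_rpow hb]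
    field_simp
    ring
  have h0 := integral_comp_of_isUniform (hp 0) (hunif 0) hfm hfi
  have hpos : 0 < Real.log (a ^ d + b ^ d) + 1 := by
    have := (Real.lt_log_iff_exp_lt (add_pos hA hB)).2 hS
    linarith
  have hfm' : Measurable fun x : unitInterval => f x := hfm.comp measurable_subtype_coe
  have hid : ∀ i, IdentDistrib (fun ω => f (p i ω)) (fun ω => f (p 0 ω)) P P := fun i => by
    have h1 : IdentDistrib (fun ω => (p i ω : ℝ)) (fun ω => (p 0 ω : ℝ)) P P :=
      ⟨(hp i).subtype_val.aemeasurable, (hp 0).subtype_val.aemeasurable,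
        (hunif i).trans (hunif 0).symm⟩
    exact h1.comp hfm
  have hslln := strong_law_ae_real (fun i ω => f (p i ω)) h0.1
    (fun i j hij => (hindep.comp (fun _ => fun x : unitInterval => f x)
      fun _ => hfm').indepFun hij) hid
  filter_upwards [hslln, ae_all_iff.2 fun n => ae_mem_Ioo_of_isUniform (hp n) (hunif n)]
    with ω hlim hω
  rw [h0.2, hfint] at hlim
  have h1 := hlim.pos_mul_atTop hpos tendsto_natCast_atTop_atTop
  have h2 := Real.tendsto_exp_atTop.comp h1
  refine h2.congr' ?_
  filter_upwards [eventually_gt_atTop 0] with n hn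
  have hn' : (n : ℝ) ≠ 0 := by positivity
  rw [Function.comp_apply, div_mul_cancel₀ _ hn', Real.exp_sum]
  refine Finset.prod_congr rfl fun i _ => ?_
  rw [hf]
  simp only
  rw [← log_maxBranch ha hb (hω i), Real.exp_log (maxBranch_pos ha (hω i))]

end Uniform

/-! ### Homogeneous Moran sets -/

/-- Length of the level `n` interval along `v` when the ratios are constantly `a`, `b`. -/
noncomputable def moranLength (a b : ℝ) (v : ℕ → Bool) (n : ℕ) : ℝ :=
  (moranInterval (fun _ => a) (fun _ => b) v n).2

lemma moranLength_zero (a b : ℝ) (v : ℕ → Bool) : moranLength a b v 0 = 1 := rfl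

lemma moranLength_succ (a b : ℝ) (v : ℕ → Bool) (n : ℕ) :
    moranLength a b v (n + 1) = moranLength a b v n * (if v n then b else a) := by
  unfold moranLength
  by_cases h : v n <;> simp [moranInterval, h, mul_comm]

lemma moranLength_add (a b : ℝ) (v : ℕ → Bool) (n k : ℕ) :
    moranLength a b v (n + k) =
      moranLength a b v n * ∏ i ∈ Finset.range k, (if v (n + i) then b else a) := by
  induction k with
  | zero => simp
  | succ k ih => rw [← add_assoc, moranLength_succ, ih, Finset.prod_range_succ, mul_assoc]

lemma moranLength_eq_prod (a b : ℝ) (v : ℕ → Bool) (n : ℕ) :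
    moranLength a b v n = ∏ i ∈ Finset.range n, (if v i then b else a) := by
  simpa [moranLength_zero] using moranLength_add a b v 0 n

section Deterministic

variable {a b : ℝ}

lemma moranLength_pos (ha : 0 < a) (hb : 0 < b) (v : ℕ → Bool) (n : ℕ) :
    0 < moranLength a b v n := by
  rw [moranLength_eq_prod]
  exact Finset.prod_pos fun i _ => by split_ifs <;> assumption

lemma moranLength_mul_pow_le (ha : 0 < a) (hb : 0 < b) (v : ℕ → Bool) (n k : ℕ) :
    moranLength a b v n * min a b ^ k ≤ moranLength a b v (n + k) := by
  rw [moranLength_add]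
  refine mul_le_mul_of_nonneg_left ?_ (moranLength_pos ha hb v n).le
  rw [← Finset.card_range k, ← Finset.prod_const, Finset.card_range]
  refine Finset.prod_le_prod (fun i _ => (lt_min ha hb).le) fun i _ => ?_
  split_ifs
  · exact min_le_right _ _
  · exact min_le_left _ _

lemma moranLength_le_pow (ha : 0 < a) (hb : 0 < b) (v : ℕ → Bool) (n : ℕ) :
    moranLength a b v n ≤ max a b ^ n := by
  rw [moranLength_eq_prod, ← Finset.card_range n, ← Finset.prod_const, Finset.card_range]
  refine Finset.prod_le_prod (fun i _ => by split_ifs <;> positivity) fun i _ => ?_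
  split_ifs
  · exact le_max_right _ _
  · exact le_max_left _ _

lemma moranLength_antitone (ha : 0 < a) (hb : 0 < b) (hab : a + b < 1) (v : ℕ → Bool) :
    Antitone (moranLength a b v) := by
  refine antitone_nat_of_succ_le fun n => ?_
  rw [moranLength_succ]
  refine mul_le_of_le_one_right (moranLength_pos ha hb v n).le ?_
  split_ifs <;> linarith

lemma tendsto_moranLength (ha : 0 < a) (hb : 0 < b) (hab : a + b < 1) (v : ℕ → Bool) :
    Tendsto (moranLength a b v) atTop (𝓝 0) :=
  squeeze_zero (fun n => (moranLength_pos ha hb v n).le) (moranLength_le_pow ha hb v)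
    (tendsto_pow_atTop_nhds_zero_of_lt_one (le_max_of_le_left ha.le)
      (max_lt (by linarith) (by linarith)))

/-- Codes of points of the Moran set that are close to each other have a common beginning. -/
lemma eq_of_dist_moranPoint_lt (ha : 0 < a) (hb : 0 < b) (hab : a + b < 1) (v w : ℕ → Bool) (n : ℕ)
    (h : dist (moranPoint (fun _ => a) (fun _ => b) w) (moranPoint (fun _ => a) (fun _ => b) v) <
      (1 - a - b) * moranLength a b v n) : ∀ i < n + 1, w i = v i := by
  intro i
  induction i using Nat.strong_induction_on with
  | _ j ih =>
    intro hj
    by_contra hne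
    have hagree : ∀ i < j, w i = v i := fun i hi => ih i hi (hi.trans hj)
    have heq := moranInterval_congr (fun _ => a) (fun _ => b) hagree
    have hv := moranPoint_mem (a := fun _ => a) (b := fun _ => b) (fun _ => ha) (fun _ => hb)
      (fun _ => hab) v (j + 1)
    have hw := moranPoint_mem (a := fun _ => a) (b := fun _ => b) (fun _ => ha) (fun _ => hb)
      (fun _ => hab) w (j + 1)
    have hlen : moranLength a b v n ≤ moranLength a b v j :=
      moranLength_antitone ha hb hab v (by omega)
    have h' := h.trans_le (mul_le_mul_of_nonneg_left hlen (by linarith : 0 ≤ 1 - a - b))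
    rw [Real.dist_eq, abs_lt] at h'
    unfold moranLength at h'
    unfold moranCell at hv hw
    clear h hlen ih
    cases hv' : v j <;> cases hw' : w j <;>
      simp [moranInterval, heq, hv', hw'] at hv hw hne <;>
      nlinarith [hv.1, hv.2, hw.1, hw.2, h'.1, h'.2]

variable {p : ℕ → unitInterval}

instance : IsProbabilityMeasure (moranMeasure (fun _ => a) (fun _ => b) p) :=
  Measure.isProbabilityMeasure_map (measurable_moranPoint _ _).aemeasurable

/-- The product of the probabilities of the branches along `v` in the passage from level `n` to
level `n + k`. -/
noncomputable def branchProb (p : ℕ → unitInterval) (v : ℕ → Bool) (n k : ℕ) : ℝ :=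
  ∏ i ∈ Finset.range k, (if v (n + i) then 1 - (p (n + i) : ℝ) else p (n + i))

lemma branchProb_pos (hp : ∀ n, (p n : ℝ) ∈ Ioo (0 : ℝ) 1) (v : ℕ → Bool) (n k : ℕ) :
    0 < branchProb p v n k := by
  refine Finset.prod_pos fun i _ => ?_
  have := hp (n + i)
  split_ifs
  · linarith [this.2]
  · exact this.1

lemma branchProb_add (v : ℕ → Bool) (n k : ℕ) :
    branchProb p v 0 (n + k) = branchProb p v 0 n * branchProb p v n k := by
  simp [branchProb, Finset.prod_range_add]

lemma moranMeasure_cell (ha : 0 < a) (hb : 0 < b) (hab : a + b < 1) (v : ℕ → Bool) (n : ℕ) :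
    moranMeasure (fun _ => a) (fun _ => b) p (moranCell (fun _ => a) (fun _ => b) v n) =
      ENNReal.ofReal (branchProb p v 0 n) := by
  rw [moranMeasure_moranCell (fun _ => ha) (fun _ => hb) (fun _ => hab), branchProb,
    ENNReal.ofReal_prod_of_nonneg]
  · simp
  · intro i _
    split_ifs
    · linarith [(p (0 + i)).2.2]
    · exact (p (0 + i)).2.1

lemma moranMeasure_ball_le (ha : 0 < a) (hb : 0 < b) (hab : a + b < 1) (v : ℕ → Bool) (n : ℕ)
    {R : ℝ} (hR : R ≤ (1 - a - b) * moranLength a b v n) :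
    moranMeasure (fun _ => a) (fun _ => b) p
      (Metric.ball (moranPoint (fun _ => a) (fun _ => b) v) R) ≤
      ENNReal.ofReal (branchProb p v 0 (n + 1)) := by
  rw [← moranMeasure_cell ha hb hab, moranMeasure,
    Measure.map_apply (measurable_moranPoint _ _) measurableSet_ball,
    Measure.map_apply (measurable_moranPoint _ _) (by exact measurableSet_Icc)]
  refine measure_mono fun w hw => ?_
  rw [mem_preimage, moranPoint_mem_iff (fun _ => ha) (fun _ => hb) (fun _ => hab)]
  exact eq_of_dist_moranPoint_lt ha hb hab v w n ((Metric.mem_ball.1 hw).trans_le hR)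

lemma le_moranMeasure_ball (ha : 0 < a) (hb : 0 < b) (hab : a + b < 1) (v : ℕ → Bool) (n : ℕ)
    {r : ℝ} (hr : moranLength a b v n < r) :
    ENNReal.ofReal (branchProb p v 0 n) ≤ moranMeasure (fun _ => a) (fun _ => b) p
      (Metric.ball (moranPoint (fun _ => a) (fun _ => b) v) r) := by
  rw [← moranMeasure_cell ha hb hab]
  refine measure_mono fun x hx => ?_
  have hv := moranPoint_mem (a := fun _ => a) (b := fun _ => b) (fun _ => ha) (fun _ => hb)
    (fun _ => hab) v n
  unfold moranCell at hx hv
  unfold moranLength at hr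
  rw [Metric.mem_ball, Real.dist_eq, abs_lt]
  constructor <;> linarith [hx.1, hx.2, hv.1, hv.2]

lemma moranPoint_mem_support (ha : 0 < a) (hb : 0 < b) (hab : a + b < 1)
    (hp : ∀ n, (p n : ℝ) ∈ Ioo (0 : ℝ) 1) (v : ℕ → Bool) :
    moranPoint (fun _ => a) (fun _ => b) v ∈
      (moranMeasure (fun _ => a) (fun _ => b) p).support := by
  rw [Measure.mem_support_iff_forall]
  intro U hU
  obtain ⟨r, hr, hrU⟩ := Metric.mem_nhds_iff.1 hU
  obtain ⟨n, hn⟩ := ((tendsto_moranLength ha hb hab v).eventually_lt_const hr).exists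
  exact ((ENNReal.ofReal_pos.2 (branchProb_pos hp v 0 n)).trans_le
    (le_moranMeasure_ball ha hb hab v n hn)).trans_le (measure_mono hrU)

lemma exists_dist_moranPoint_lt {x r : ℝ}
    (hx : x ∈ (moranMeasure (fun _ => a) (fun _ => b) p).support) (hr : 0 < r) :
    ∃ v, dist (moranPoint (fun _ => a) (fun _ => b) v) x < r := by
  have h := (Measure.mem_support_iff_forall x).1 hx _ (Metric.ball_mem_nhds x hr)
  rw [moranMeasure, Measure.map_apply (measurable_moranPoint _ _) measurableSet_ball] at h
  exact nonempty_of_measure_ne_zero h.ne'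

/-- The level at which the lengths of the intervals along `v` pass below `t`. -/
lemma exists_moranLength_lt_le (ha : 0 < a) (hb : 0 < b) (hab : a + b < 1) (v : ℕ → Bool) {t : ℝ}
    (ht : 0 < t) (ht1 : t ≤ 1) :
    ∃ n, moranLength a b v (n + 1) < t ∧ t ≤ moranLength a b v n := by
  have hex := ((tendsto_moranLength ha hb hab v).eventually_lt_const ht).exists
  classical
  have h0 : Nat.find hex ≠ 0 := fun h => by
    have := Nat.find_spec hex
    rw [h, moranLength_zero] at this
    linarith
  obtain ⟨n, hn⟩ := Nat.exists_eq_succ_of_ne_zero h0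
  refine ⟨n, ?_, not_lt.1 (Nat.find_min hex (by omega))⟩
  have := Nat.find_spec hex
  rwa [hn] at this

/-- Comparison of the masses of two concentric balls with those of two nested intervals. -/
lemma exists_levels (ha : 0 < a) (hb : 0 < b) (hab : a + b < 1) (v : ℕ → Bool) {r R : ℝ}
    (hr : 0 < r) (hrR : r < min a b * R) (hR : R ≤ 1 - a - b) :
    ∃ N k : ℕ, min a b ^ N ≤ R / (1 - a - b) ∧ min a b * R ≤ max a b ^ N ∧
      min a b ^ (k + 1) * R ≤ r ∧
      moranLength a b v N / moranLength a b v (N + k) ≤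
        ((1 - a - b) * min a b)⁻¹ * (R / r) ∧
      moranMeasure (fun _ => a) (fun _ => b) p
        (Metric.ball (moranPoint (fun _ => a) (fun _ => b) v) R) ≤
        ENNReal.ofReal (branchProb p v 0 N) ∧
      ENNReal.ofReal (branchProb p v 0 (N + k)) ≤ moranMeasure (fun _ => a) (fun _ => b) p
        (Metric.ball (moranPoint (fun _ => a) (fun _ => b) v) r) := by
  have hc : 0 < min a b := lt_min ha hb
  have hc1 : min a b < 1 := (min_le_left _ _).trans_lt (by linarith)
  have hg : 0 < 1 - a - b := by linarith
  have hg1 : 1 - a - b < 1 := by linarith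
  have hR0 : 0 < R := by
    by_contra! h
    nlinarith
  -- Stopping at length `R / (1 - a - b)` rather than `R` makes the gaps inside the intervals up to
  -- level `n` at least `R`, so the ball of radius `R` sees only one interval of level `n + 1`.
  obtain ⟨n, hn1, hn2⟩ := exists_moranLength_lt_le ha hb hab v (div_pos hR0 hg)
    ((div_le_one hg).2 hR)
  have hrltR : r < R := hrR.trans (mul_lt_of_lt_one_left hR0 hc1)
  obtain ⟨m, hm1, hm2⟩ := exists_moranLength_lt_le ha hb hab v hr (by linarith)
  have hRg : R ≤ R / (1 - a - b) := by
    rw [le_div_iff₀ hg]; nlinarith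
  have hNlow : min a b * R ≤ moranLength a b v (n + 1) := by
    have := moranLength_mul_pow_le ha hb v n 1
    rw [pow_one] at this
    nlinarith
  have hmlow : min a b * r ≤ moranLength a b v (m + 1) := by
    have := moranLength_mul_pow_le ha hb v m 1
    rw [pow_one] at this
    nlinarith
  -- Otherwise the level `n + 1` interval would be shorter than `r`, against `r < min a b * R`.
  have hNm : n + 1 ≤ m + 1 := by
    by_contra! h
    have := moranLength_antitone ha hb hab v h.le
    linarith
  obtain ⟨k, hk⟩ := Nat.exists_eq_add_of_le hNm
  have hlpos := fun n => moranLength_pos ha hb v n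
  refine ⟨n + 1, k, ?_, hNlow.trans (moranLength_le_pow ha hb v _), ?_, ?_, ?_, ?_⟩
  · have := moranLength_mul_pow_le ha hb v 0 (n + 1)
    rw [moranLength_zero, one_mul, zero_add] at this
    linarith
  · have h1 := moranLength_mul_pow_le ha hb v (n + 1) k
    rw [← hk] at h1
    have h2 := mul_le_mul_of_nonneg_right hNlow (pow_pos hc k).le
    calc min a b ^ (k + 1) * R = min a b * R * min a b ^ k := by ring
      _ ≤ r := by linarith
  · rw [← hk, div_le_iff₀ (hlpos _)]
    calc moranLength a b v (n + 1) ≤ R / (1 - a - b) := hn1.le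
      _ = ((1 - a - b) * min a b)⁻¹ * (R / r) * (min a b * r) := by field_simp
      _ ≤ _ := by gcongr
  · refine moranMeasure_ball_le ha hb hab v n ?_
    rw [div_le_iff₀ hg] at hn2
    linarith
  · rw [← hk]
    exact le_moranMeasure_ball ha hb hab v _ hm1

/-- The bound on the masses of nested intervals in terms of their lengths. -/
lemma rpow_le_branchProb_mul_maxBranch (ha : 0 < a) (hb : 0 < b)
    (hp : ∀ n, (p n : ℝ) ∈ Ioo (0 : ℝ) 1) (v : ℕ → Bool) (n k : ℕ) (d : ℝ) :
    (moranLength a b v (n + k) / moranLength a b v n) ^ d ≤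
      branchProb p v n k * ∏ i ∈ Finset.range k, maxBranch a b d (p (n + i)) := by
  rw [moranLength_add, mul_div_cancel_left₀ _ (moranLength_pos ha hb v n).ne',
    ← Real.finsetProd_rpow _ _ (fun i _ => by split_ifs <;> positivity), branchProb,
    ← Finset.prod_mul_distrib]
  refine Finset.prod_le_prod (fun i _ => by split_ifs <;> positivity) fun i _ => ?_
  have := hp (n + i)
  have h1 : 0 < 1 - (p (n + i) : ℝ) := by linarith [this.2]
  split_ifs
  · rw [← div_le_iff₀' h1]; exact le_max_right _ _
  · rw [← div_le_iff₀' this.1]; exact le_max_left _ _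

end Deterministic

/-- For small `R` the levels provided by `exists_levels` are large, and their difference is large
compared to the logarithm of the first one. -/
lemma IsLargeDimensionFunction.eventually_levels {Φ : ℝ → ℝ} (hΦ : IsLargeDimensionFunction Φ)
    {c C g A : ℝ} (hc0 : 0 < c) (hc1 : c < 1) (hC0 : 0 < C) (hC1 : C < 1) (hg : 0 < g) (hA : 0 < A)
    (N₀ : ℕ) :
    ∀ᶠ R in 𝓝[>] (0 : ℝ), ∀ r, 0 < r → r < R ^ (1 + Φ R) → r / 2 < c * (2 * R) ∧
      ∀ N k : ℕ, c ^ N ≤ 2 * R / g → c * (2 * R) ≤ C ^ N → c ^ (k + 1) * (2 * R) ≤ r / 2 →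
        N₀ ≤ N ∧ A * Real.log (N + 1) ≤ k := by
  obtain ⟨-, H, hH, hΦH⟩ := hΦ
  have hκ : 0 < -Real.log c := neg_pos.2 (Real.log_neg hc0 hc1)
  have hl : 0 < -Real.log C := neg_pos.2 (Real.log_neg hC0 hC1)
  set κ := -Real.log c with hκd
  set l := -Real.log C with hld
  have hT : Tendsto (fun R => -Real.log R) (𝓝[>] 0) atTop :=
    tendsto_neg_atBot_atTop.comp Real.tendsto_log_nhdsGT_zero
  -- With `T = -log R`, the level `N` is at most linear in `T`; hence `N + 1 ≤ T ^ 2` and `log (N +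
  -- 1) ≤ 2 log T`.
  have hquad : ∀ᶠ T : ℝ in atTop, (T + κ) / l + 1 ≤ T ^ 2 := by
    have h1 : Tendsto (fun T : ℝ => T * (T - 1 / l)) atTop atTop :=
      tendsto_id.atTop_mul_atTop₀ (tendsto_atTop_add_const_right _ _ tendsto_id)
    filter_upwards [h1.eventually_ge_atTop (κ / l + 1)] with T hT
    have : (T + κ) / l + 1 = T * (1 / l) + (κ / l + 1) := by ring
    nlinarith
  -- Since `log r < -T - H(R) log T`, the bound `H ≥ (2A + 1)κ` yields `k + 1 > (2A + 1) log T`. As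
  -- `log T ≥ 1`, the extra `log T` pays for the `1`, leaving `k ≥ 2A log T ≥ A log (N + 1)`. The
  -- last threshold forces `N ≥ N₀`.
  filter_upwards [self_mem_nhdsWithin, hH.eventually_ge_atTop ((2 * A + 1) * κ), hΦH,
    hT.eventually_ge_atTop (Real.exp 1), hT.eventually hquad,
    hT.eventually_ge_atTop (N₀ * κ + Real.log 2 - Real.log g)] with R hR hHR hΦR hTe hTq hTN
  have hR : 0 < R := hR
  intro r hr hrR
  set T := -Real.log R with hTd
  have hT0 : 0 < T := (Real.exp_pos 1).trans_le hTe
  have hlogR : Real.log R = -T := by rw [hTd]; ring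
  have hh : 1 ≤ Real.log T := (Real.le_log_iff_exp_le hT0).2 hTe
  have hlog2 : 0 < Real.log 2 := Real.log_pos one_lt_two
  have hlogr : Real.log r < -T - H R * Real.log T := by
    have h1 := Real.log_lt_log hr hrR
    rw [Real.log_rpow hR, hΦR, hlogR, abs_neg, abs_of_pos hT0] at h1
    have h2 : (1 + H R * (Real.log T / T)) * -T = -T - H R * Real.log T := by
      field_simp; ring
    linarith
  have hHh : (2 * A + 1) * κ * Real.log T ≤ H R * Real.log T :=
    mul_le_mul_of_nonneg_right hHR (by linarith)
  have hAκ := mul_pos hA hκ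
  have h2R : Real.log (2 * R) = Real.log 2 - T := by
    rw [Real.log_mul two_ne_zero hR.ne', hlogR]; ring
  have hr2 : Real.log (r / 2) = Real.log r - Real.log 2 := Real.log_div hr.ne' two_ne_zero
  refine ⟨?_, fun N k h1 h2 h3 => ⟨?_, ?_⟩⟩
  · rw [← Real.log_lt_log_iff (by positivity) (by positivity), hr2,
      Real.log_mul hc0.ne' (by positivity), h2R]
    have : κ ≤ (2 * A + 1) * κ * Real.log T := by nlinarith
    linarith
  · have := Real.log_le_log (by positivity) h1
    rw [Real.log_pow, Real.log_div (by positivity) hg.ne', h2R] at this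
    have h4 : (N₀ : ℝ) * κ ≤ N * κ := by
      rw [hκd] at hTN ⊢
      linarith
    exact_mod_cast le_of_mul_le_mul_right h4 hκ
  · have hN := Real.log_le_log (by positivity) h2
    rw [Real.log_pow, Real.log_mul hc0.ne' (by positivity), h2R] at hN
    have hN1 : (N : ℝ) ≤ (T + κ) / l := by
      rw [le_div_iff₀ hl, hld, hκd]
      linarith
    have hN2 : Real.log (N + 1) ≤ 2 * Real.log T := by
      have := Real.log_le_log (by positivity) (show (N : ℝ) + 1 ≤ T ^ 2 by linarith)
      rwa [Real.log_pow, Nat.cast_ofNat] at this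
    have hk := Real.log_le_log (by positivity) h3
    rw [Real.log_mul (by positivity) (by positivity), Real.log_pow, h2R, hr2] at hk
    push_cast at hk
    have hk1 : (2 * A + 1) * Real.log T * κ < (k + 1) * κ := by
      have : ((k : ℝ) + 1) * Real.log c = -((k + 1) * κ) := by rw [hκd]; ring
      linarith
    have hk2 := lt_of_mul_lt_mul_right hk1 hκ.le
    nlinarith

/-! ### Dimension bounds for a fixed sequence of probabilities -/

section

variable {a b : ℝ} {p : ℕ → unitInterval}

/-- When the product over a window is at most `1`, the conditional mass of the inner interval is at
least the length ratio to the power `d`. -/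
lemma upperPhiDim_moranMeasure_le (ha : 0 < a) (hb : 0 < b) (hab : a + b < 1)
    (hp : ∀ n, (p n : ℝ) ∈ Ioo (0 : ℝ) 1) {d A : ℝ} (hd : 0 ≤ d) (hA : 0 < A) {N₀ : ℕ}
    (hprod : ∀ n ≥ N₀, ∀ k : ℕ, A * Real.log (n + 1) ≤ k →
      ∏ i ∈ Finset.range k, maxBranch a b d (p (n + i)) ≤ 1)
    {Φ : ℝ → ℝ} (hΦ : IsLargeDimensionFunction Φ) :
    upperPhiDim Φ (moranMeasure (fun _ => a) (fun _ => b) p) ≤ d := by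
  have hg : 0 < 1 - a - b := by linarith
  have hc0 : 0 < min a b := lt_min ha hb
  have hev := hΦ.eventually_levels hc0 ((min_le_left _ _).trans_lt (by linarith))
    (C := max a b) (lt_max_of_lt_left ha) (max_lt (by linarith) (by linarith)) hg hA N₀
  obtain ⟨ε, hε, hεR⟩ := mem_nhdsGT_iff_exists_Ioc_subset.1 hev
  have hε : (0 : ℝ) < ε := hε
  refine sInf_le ⟨d, ⟨min ε (min (1 / 2) ((1 - a - b) / 2)),
    (((1 - a - b) * min a b)⁻¹ * 4) ^ d, by positivity, ?_, by positivity, ?_⟩, rfl⟩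
  · exact (min_le_right _ _).trans_lt ((min_le_left _ _).trans_lt (by norm_num))
  intro r R hr hrR hRR hR x hx
  have hR0 : 0 < R := hr.trans (hrR.trans_le hRR)
  have hRε : R ≤ ε := hR.trans (min_le_left _ _)
  have hRg : R ≤ (1 - a - b) / 2 := hR.trans ((min_le_right _ _).trans (min_le_right _ _))
  obtain ⟨h1, h2⟩ := hεR ⟨hR0, hRε⟩ r hr hrR
  -- A point of the support need not be given with a code, so the centre moves to a coded point
  -- within `r / 2`. The radii become `2R` and `r / 2`, whence the factor `4` in the constant.
  obtain ⟨v, hv⟩ := exists_dist_moranPoint_lt hx (half_pos hr)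
  obtain ⟨N, k, e1, e2, e3, e4, e5, e6⟩ :=
    exists_levels (p := p) ha hb hab v (half_pos hr) h1 (by linarith : 2 * R ≤ 1 - a - b)
  obtain ⟨hN, hk⟩ := h2 N k e1 e2 e3
  have hrltR : r < R := hrR.trans_le hRR
  have i1 : moranMeasure (fun _ => a) (fun _ => b) p (Metric.ball x R) ≤
      ENNReal.ofReal (branchProb p v 0 N) := by
    refine (measure_mono (Metric.ball_subset_ball' ?_)).trans e5
    rw [dist_comm]
    linarith
  have i2 : ENNReal.ofReal (branchProb p v 0 (N + k)) ≤
      moranMeasure (fun _ => a) (fun _ => b) p (Metric.ball x r) :=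
    e6.trans (measure_mono (Metric.ball_subset_ball' (by linarith)))
  have hpos := branchProb_pos hp v
  have hlpos := moranLength_pos ha hb v
  refine (ENNReal.div_le_div i1 i2).trans ?_
  rw [← ENNReal.ofReal_div_of_pos (hpos 0 _)]
  refine ENNReal.ofReal_le_ofReal ?_
  rw [branchProb_add, div_mul_cancel_left₀ (hpos 0 N).ne']
  have i3 : (moranLength a b v (N + k) / moranLength a b v N) ^ d ≤ branchProb p v N k :=
    (rpow_le_branchProb_mul_maxBranch ha hb hp v N k d).trans
      (mul_le_of_le_one_right (hpos N k).le (hprod N hN k hk))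
  calc (branchProb p v N k)⁻¹
      ≤ ((moranLength a b v (N + k) / moranLength a b v N) ^ d)⁻¹ :=
        inv_anti₀ (Real.rpow_pos_of_pos (div_pos (hlpos _) (hlpos _)) _) i3
    _ = (moranLength a b v N / moranLength a b v (N + k)) ^ d := by
        rw [← Real.inv_rpow (div_pos (hlpos _) (hlpos _)).le, inv_div]
    _ ≤ (((1 - a - b) * min a b)⁻¹ * (2 * R / (r / 2))) ^ d :=
        Real.rpow_le_rpow (div_pos (hlpos _) (hlpos _)).le e4 hd
    _ = (((1 - a - b) * min a b)⁻¹ * 4) ^ d * (R / r) ^ d := by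
        rw [← Real.mul_rpow (by positivity) (by positivity)]
        congr 1
        ring

/-- Only `r → 0` with one fixed `R` is needed, so `Φ` need not be large: along the maximizing path
the cell mass is length^d divided by an unbounded product. -/
lemma le_upperPhiDim_moranMeasure (ha : 0 < a) (hb : 0 < b) (hab : a + b < 1)
    (hp : ∀ n, (p n : ℝ) ∈ Ioo (0 : ℝ) 1) {d : ℝ}
    (hprod : Tendsto (fun n => ∏ i ∈ Finset.range n, maxBranch a b d (p i)) atTop atTop)
    {Φ : ℝ → ℝ} (hΦ : IsDimensionFunction Φ) :
    d ≤ upperPhiDim Φ (moranMeasure (fun _ => a) (fun _ => b) p) := by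
  refine le_sInf ?_
  rintro _ ⟨d', ⟨R, K, hR0, hR1, hK, h⟩, rfl⟩
  rw [EReal.coe_le_coe_iff]
  by_contra! hlt
  have hg : 0 < 1 - a - b := by linarith
  have hA := Real.rpow_pos_of_pos ha d
  have hB := Real.rpow_pos_of_pos hb d
  have hΦR := hΦ.1 R ⟨hR0, hR1⟩
  have hRR : R ^ (1 + Φ R) ≤ R := by
    conv_rhs => rw [← Real.rpow_one R]
    exact Real.rpow_le_rpow_of_exponent_ge hR0 hR1.le (by linarith)
  -- The path taking the branch that attains `maxBranch` at every level, with ties going left.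
  set v : ℕ → Bool := fun n => decide (a ^ d / p n < b ^ d / (1 - p n)) with hv
  have hmax : ∀ n, maxBranch a b d (p n) =
      (if v n then b else a) ^ d / (if v n then 1 - (p n : ℝ) else p n) := by
    intro n
    by_cases h : a ^ d / p n < b ^ d / (1 - p n)
    · simp [hv, h, maxBranch, max_eq_right h.le]
    · simp [hv, h, maxBranch, max_eq_left (not_lt.1 h)]
  set μ := moranMeasure (fun _ => a) (fun _ => b) p with hμ
  set x := moranPoint (fun _ => a) (fun _ => b) v with hx
  have hxs : x ∈ μ.support := moranPoint_mem_support ha hb hab hp v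
  have hpos := branchProb_pos hp v
  have hlpos := moranLength_pos ha hb v
  have hball : ∀ r, 0 < r → 0 < μ (Metric.ball x r) := fun r hr =>
    (Measure.mem_support_iff_forall x).1 hxs _ (Metric.ball_mem_nhds x hr)
  set m := (μ (Metric.ball x R)).toReal with hm
  have hm0 : 0 < m := ENNReal.toReal_pos (hball R hR0).ne' (measure_ne_top _ _)
  have hprodEq : ∀ n, branchProb p v 0 n * ∏ i ∈ Finset.range n, maxBranch a b d (p i) =
      moranLength a b v n ^ d := by
    intro n
    rw [moranLength_eq_prod, ← Real.finsetProd_rpow _ _ (fun i _ => by split_ifs <;> positivity),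
      branchProb, ← Finset.prod_mul_distrib]
    refine Finset.prod_congr rfl fun i _ => ?_
    have hne : (if v i then 1 - (p i : ℝ) else p i) ≠ 0 := by
      have := hp i
      split_ifs
      · linarith [this.2]
      · exact this.1.ne'
    rw [hmax, zero_add, mul_div_cancel₀ _ hne]
  have hsmall : ∀ᶠ n in atTop, (1 - a - b) * moranLength a b v n < R ^ (1 + Φ R) := by
    have := (tendsto_moranLength ha hb hab v).const_mul (1 - a - b)
    rw [mul_zero] at this
    exact this.eventually_lt_const (by positivity)
  -- The shift by one is there because the ball of radius `(1 - a - b)` times the level `n` length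
  -- has at most the mass of the level `n + 1` interval; `a ^ d + b ^ d` absorbs the ratio of that
  -- last step.
  have hbig := (hprod.comp (tendsto_add_atTop_nat 1)).eventually_gt_atTop
    (K * (R / (1 - a - b)) ^ d * (a ^ d + b ^ d) / m)
  obtain ⟨n, hn1, hn2⟩ := (hsmall.and hbig).exists
  rw [Function.comp_apply, div_lt_iff₀ hm0] at hn2
  set r := (1 - a - b) * moranLength a b v n with hr
  have hr0 : 0 < r := mul_pos hg (hlpos n)
  have hrR : r < R := hn1.trans_le hRR
  have key := h r R hr0 hn1 hRR le_rfl x hxs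
  rw [ENNReal.div_le_iff (hball r hr0).ne' (measure_ne_top _ _)] at key
  have key2 := key.trans (mul_le_mul_right (moranMeasure_ball_le ha hb hab v n hr.le) _)
  rw [← ENNReal.ofReal_mul (by positivity)] at key2
  have key3 : m ≤ K * (R / r) ^ d' * branchProb p v 0 (n + 1) :=
    ENNReal.toReal_le_of_le_ofReal (mul_nonneg (by positivity) (hpos _ _).le) key2
  have hexp : (R / r) ^ d' ≤ (R / r) ^ d :=
    Real.rpow_le_rpow_of_exponent_le ((one_le_div hr0).2 hrR.le) hlt.le
  have hW : 0 < ∏ i ∈ Finset.range (n + 1), maxBranch a b d (p i) :=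
    Finset.prod_pos fun i _ => maxBranch_pos ha (hp i)
  have hle : (if v n then b else a) ^ d ≤ a ^ d + b ^ d := by
    split_ifs <;> linarith
  have hRr : (R / r) ^ d * moranLength a b v n ^ d = (R / (1 - a - b)) ^ d := by
    rw [← Real.mul_rpow (by positivity) (hlpos n).le]
    congr 1
    have := (hlpos n).ne'
    rw [hr]
    field_simp
  have : (∏ i ∈ Finset.range (n + 1), maxBranch a b d (p i)) * m ≤
      K * (R / (1 - a - b)) ^ d * (a ^ d + b ^ d) := by
    calc _ ≤ (∏ i ∈ Finset.range (n + 1), maxBranch a b d (p i)) *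
          (K * (R / r) ^ d * branchProb p v 0 (n + 1)) := by
          refine mul_le_mul_of_nonneg_left (key3.trans ?_) hW.le
          exact mul_le_mul_of_nonneg_right (mul_le_mul_of_nonneg_left hexp hK.le) (hpos _ _).le
      _ = K * (R / r) ^ d * moranLength a b v (n + 1) ^ d := by
          rw [← hprodEq (n + 1)]; ring
      _ = K * (R / (1 - a - b)) ^ d * (if v n then b else a) ^ d := by
          rw [moranLength_succ, Real.mul_rpow (hlpos n).le (by split_ifs <;> positivity), ← hRr]
          ring
      _ ≤ _ := mul_le_mul_of_nonneg_left hle (by positivity)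
  linarith

end

/-! ### The equation `a ^ θ + b ^ θ = e⁻¹` -/

lemma strictAnti_rpow_add_rpow {a b : ℝ} (ha : 0 < a) (hb : 0 < b) (ha1 : a < 1) (hb1 : b < 1) :
    StrictAnti fun θ : ℝ => a ^ θ + b ^ θ := fun _ _ h =>
  add_lt_add (Real.rpow_lt_rpow_of_exponent_gt ha ha1 h) (Real.rpow_lt_rpow_of_exponent_gt hb hb1 h)

lemma exists_rpow_add_rpow_eq {a b : ℝ} (ha : 0 < a) (hb : 0 < b) (ha1 : a < 1) (hb1 : b < 1) :
    ∃ θ : ℝ, 0 < θ ∧ a ^ θ + b ^ θ = Real.exp (-1) := by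
  have hcont : Continuous fun θ : ℝ => a ^ θ + b ^ θ :=
    (Real.continuous_const_rpow ha.ne').add (Real.continuous_const_rpow hb.ne')
  have hlim : Tendsto (fun θ : ℝ => a ^ θ + b ^ θ) atTop (𝓝 (0 + 0)) :=
    (tendsto_rpow_atTop_of_base_lt_one a (by linarith) ha1).add
      (tendsto_rpow_atTop_of_base_lt_one b (by linarith) hb1)
  rw [add_zero] at hlim
  obtain ⟨M, hM, hM0⟩ :=
    ((hlim.eventually_lt_const (Real.exp_pos (-1))).and (eventually_gt_atTop 0)).exists
  have h0 : Real.exp (-1) < a ^ (0 : ℝ) + b ^ (0 : ℝ) := by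
    have : Real.exp (-1) < 1 := Real.exp_lt_one_iff.2 (by norm_num)
    simp only [Real.rpow_zero]
    linarith
  obtain ⟨θ, hθ, hθe⟩ := intermediate_value_Icc' hM0.le hcont.continuousOn ⟨hM.le, h0.le⟩
  refine ⟨θ, lt_of_le_of_ne hθ.1 ?_, hθe⟩
  rintro rfl
  exact h0.ne' hθe

open Classical in
/-- The almost sure upper `Φ`-dimension of the random Moran measure with ratios `a`, `b`: the root
of `a ^ θ + b ^ θ = e⁻¹`. -/
noncomputable def moranDim (a b : ℝ) : ℝ :=
  if h : ∃ θ : ℝ, 0 < θ ∧ a ^ θ + b ^ θ = Real.exp (-1) then h.choose else 0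

section MoranDim

variable {a b : ℝ}

lemma moranDim_spec (ha : 0 < a) (hb : 0 < b) (hab : a + b < 1) :
    0 < moranDim a b ∧ a ^ moranDim a b + b ^ moranDim a b = Real.exp (-1) := by
  have h := exists_rpow_add_rpow_eq ha hb (by linarith) (by linarith)
  rw [moranDim, dif_pos h]
  exact h.choose_spec

lemma rpow_add_rpow_eq_iff (ha : 0 < a) (hb : 0 < b) (hab : a + b < 1) (θ : ℝ) :
    a ^ θ + b ^ θ = Real.exp (-1) ↔ θ = moranDim a b := by
  rw [← (moranDim_spec ha hb hab).2]
  exact (strictAnti_rpow_add_rpow ha hb (by linarith) (by linarith)).injective.eq_iff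

lemma rpow_add_rpow_lt_iff (ha : 0 < a) (hb : 0 < b) (hab : a + b < 1) (θ : ℝ) :
    a ^ θ + b ^ θ < Real.exp (-1) ↔ moranDim a b < θ := by
  rw [← (moranDim_spec ha hb hab).2]
  exact (strictAnti_rpow_add_rpow ha hb (by linarith) (by linarith)).lt_iff_gt

lemma lt_rpow_add_rpow_iff (ha : 0 < a) (hb : 0 < b) (hab : a + b < 1) (θ : ℝ) :
    Real.exp (-1) < a ^ θ + b ^ θ ↔ θ < moranDim a b := by
  rw [← (moranDim_spec ha hb hab).2]
  exact (strictAnti_rpow_add_rpow ha hb (by linarith) (by linarith)).lt_iff_gt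

end MoranDim

/-- By monotonicity `D < ε` means `a^ε + b^ε < e⁻¹`, and the left side tends to `0`. -/
lemma tendsto_moranDim_nhds_zero :
    Tendsto (fun q : ℝ × ℝ => moranDim q.1 q.2)
      (𝓝[{q : ℝ × ℝ | 0 < q.1 ∧ 0 < q.2 ∧ q.1 + q.2 < 1}] (0, 0)) (𝓝 0) := by
  refine tendsto_order.2 ⟨fun ε hε => ?_, fun ε hε => ?_⟩
  · filter_upwards [self_mem_nhdsWithin] with q hq
    exact hε.trans (moranDim_spec hq.1 hq.2.1 hq.2.2).1
  · have hlim : Tendsto (fun q : ℝ × ℝ => q.1 ^ ε + q.2 ^ ε) (𝓝 (0, 0)) (𝓝 (0 ^ ε + 0 ^ ε)) :=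
      (((Real.continuousAt_rpow_const _ _ (Or.inr hε.le)).tendsto.comp
        (continuous_fst.tendsto ((0, 0) : ℝ × ℝ)))).add
      (((Real.continuousAt_rpow_const _ _ (Or.inr hε.le)).tendsto.comp
        (continuous_snd.tendsto ((0, 0) : ℝ × ℝ))))
    rw [Real.zero_rpow hε.ne', add_zero] at hlim
    filter_upwards [self_mem_nhdsWithin,
      (hlim.mono_left nhdsWithin_le_nhds).eventually_lt_const (Real.exp_pos (-1))] with q hq h
    exact (rpow_add_rpow_lt_iff hq.1 hq.2.1 hq.2.2 ε).1 h

/-- Here `f` stands for either coordinate: once it is near `1`, its `M`-th power alone exceeds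
`e⁻¹`, which forces `D > M`. -/
lemma tendsto_moranDim_atTop {f : ℝ × ℝ → ℝ}
    (hf : ∀ q : ℝ × ℝ, 0 < q.1 → 0 < q.2 → ∀ M : ℝ, f q ^ M ≤ q.1 ^ M + q.2 ^ M) :
    Tendsto (fun q : ℝ × ℝ => moranDim q.1 q.2)
      (comap f (𝓝 1) ⊓ 𝓟 {q : ℝ × ℝ | 0 < q.1 ∧ 0 < q.2 ∧ q.1 + q.2 < 1}) atTop := by
  refine tendsto_atTop.2 fun M => ?_
  have hlim : Tendsto (fun q => f q ^ M) (comap f (𝓝 1)) (𝓝 (1 ^ M)) :=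
    (Real.continuousAt_rpow_const 1 M (Or.inl one_ne_zero)).tendsto.comp tendsto_comap
  rw [Real.one_rpow] at hlim
  have h1 : Real.exp (-1) < 1 := Real.exp_lt_one_iff.2 (by norm_num)
  filter_upwards [(hlim.eventually_const_lt h1).filter_mono inf_le_left,
    mem_inf_of_right (mem_principal_self _)] with q hq hq2
  exact ((lt_rpow_add_rpow_iff hq2.1 hq2.2.1 hq2.2.2 M).1
    (hq.trans_le (hf q hq2.1 hq2.2.1 M))).le

/-! ### The random Moran measure -/

section Random

variable {Ω : Type*} [MeasurableSpace Ω] {P : Measure Ω} {p : ℕ → Ω → unitInterval} {a b : ℝ}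

/-- The exceptional sets depend only on the products of `maxBranch`, not on `Φ`. Exponents from two
sequences converging to `D` suffice, so one null set serves all `Φ`. -/
lemma ae_upperPhiDim_eq_moranDim (hp : ∀ n, Measurable (p n))
    (hunif : ∀ n, pdf.IsUniform (fun ω => (p n ω : ℝ)) (Icc (0 : ℝ) 1) P)
    (hindep : iIndepFun p P) (ha : 0 < a) (hb : 0 < b) (hab : a + b < 1) :
    ∀ᵐ ω ∂P, ∀ Φ : ℝ → ℝ, IsLargeDimensionFunction Φ →
      upperPhiDim Φ (moranMeasure (fun _ => a) (fun _ => b) (fun n => p n ω)) =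
        moranDim a b := by
  obtain ⟨u, -, hu, hulim⟩ := exists_seq_strictAnti_tendsto (moranDim a b)
  obtain ⟨l, -, hl, hllim⟩ := exists_seq_strictMono_tendsto (moranDim a b)
  have hup := fun k => ae_eventually_prod_maxBranch_le_one hp hunif hindep ha hb
    ((rpow_add_rpow_lt_iff ha hb hab (u k)).2 (hu k))
  choose A hA hup using hup
  have hlow := fun k => ae_tendsto_prod_maxBranch_atTop hp hunif hindep ha hb
    ((lt_rpow_add_rpow_iff ha hb hab (l k)).2 (hl k))
  filter_upwards [ae_all_iff.2 hup, ae_all_iff.2 hlow,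
    ae_all_iff.2 fun n => ae_mem_Ioo_of_isUniform (hp n) (hunif n)] with ω h1 h2 hω Φ hΦ
  refine le_antisymm ?_ ?_
  · refine ge_of_tendsto' (continuous_coe_real_ereal.tendsto _ |>.comp hulim) fun k => ?_
    obtain ⟨N, hN⟩ := h1 k
    exact upperPhiDim_moranMeasure_le ha hb hab hω
      ((moranDim_spec ha hb hab).1.trans (hu k)).le (hA k) hN hΦ
  · exact le_of_tendsto' (continuous_coe_real_ereal.tendsto _ |>.comp hllim) fun k =>
      le_upperPhiDim_moranMeasure ha hb hab hω (h2 k) hΦ.1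

lemma branchG_eq {u : Ω → unitInterval} (hu : Measurable u)
    (hunif : pdf.IsUniform (fun ω => (u ω : ℝ)) (Icc (0 : ℝ) 1) P)
    (ha : 0 < a) (hb : 0 < b) (θ : ℝ) :
    branchG P (fun _ => a) (fun _ => b) (fun ω => u ω) θ =
      (a ^ θ * Real.log (a ^ θ / (a ^ θ + b ^ θ)) - a ^ θ
          + b ^ θ * Real.log (b ^ θ / (a ^ θ + b ^ θ)) - b ^ θ) /
        (a ^ θ * Real.log a + b ^ θ * Real.log b) := by
  have hA := Real.rpow_pos_of_pos ha θ
  have hB := Real.rpow_pos_of_pos hb θ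
  have hY := intervalIntegral_branchLogProb ha hb θ
  have hZ := intervalIntegral_branchLogRatio ha hb θ
  rw [branchG, (integral_comp_of_isUniform hu hunif (measurable_branchLogProb a b θ) hY.1).2,
    (integral_comp_of_isUniform hu hunif (measurable_branchLogRatio a b θ) hZ.1).2, hY.2, hZ.2]
  have hS : 0 < a ^ θ + b ^ θ := by positivity
  rw [← mul_div_mul_left _ _ hS.ne']
  congr 1
  · field_simp
    ring
  · field_simp

/-- After clearing the nonzero denominator, `G(θ) = θ` becomes `S (log S + 1) = 0` with `S = a^θ +
b^θ > 0`, that is, the mean of `θ Z - Y` vanishes. -/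
lemma branchG_eq_self_iff {u : Ω → unitInterval} (hu : Measurable u)
    (hunif : pdf.IsUniform (fun ω => (u ω : ℝ)) (Icc (0 : ℝ) 1) P)
    (ha : 0 < a) (hb : 0 < b) (ha1 : a < 1) (hb1 : b < 1) (θ : ℝ) :
    branchG P (fun _ => a) (fun _ => b) (fun ω => u ω) θ = θ ↔
      a ^ θ + b ^ θ = Real.exp (-1) := by
  have hA := Real.rpow_pos_of_pos ha θ
  have hB := Real.rpow_pos_of_pos hb θ
  have hS : 0 < a ^ θ + b ^ θ := by positivity
  have hden : a ^ θ * Real.log a + b ^ θ * Real.log b < 0 :=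
    add_neg (mul_neg_of_pos_of_neg hA (Real.log_neg ha ha1))
      (mul_neg_of_pos_of_neg hB (Real.log_neg hb hb1))
  rw [branchG_eq hu hunif ha hb, div_eq_iff hden.ne, Real.log_div hA.ne' hS.ne',
    Real.log_div hB.ne' hS.ne', Real.log_rpow ha, Real.log_rpow hb]
  constructor
  · intro h
    have h1 : (a ^ θ + b ^ θ) * (Real.log (a ^ θ + b ^ θ) + 1) = 0 := by linear_combination -h
    rcases mul_eq_zero.1 h1 with h2 | h2
    · exact absurd h2 hS.ne'
    · rw [← Real.exp_log hS, show Real.log (a ^ θ + b ^ θ) = -1 by linarith]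
  · intro h
    have h1 : Real.log (a ^ θ + b ^ θ) = -1 := by rw [h, Real.log_exp]
    rw [h1]
    ring

end Random

theorem mainTheorem10 {Ω : Type*} [MeasurableSpace Ω] (P : Measure Ω) [IsProbabilityMeasure P]
    (p : ℕ → Ω → unitInterval) (hp : ∀ n, Measurable (p n))
    (hunif : ∀ n, pdf.IsUniform (fun ω => (p n ω : ℝ)) (Icc (0 : ℝ) 1) P)
    (hindep : iIndepFun p P) :
    (∀ a b : ℝ, 0 < a → 0 < b → a + b < 1 → ∀ θ : ℝ, 0 ≤ θ →
      Integrable (fun ω => branchLogProb a b (p 0 ω) θ) P ∧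
      Integrable (fun ω => branchLogRatio a b (p 0 ω) θ) P ∧
      branchG P (fun _ => a) (fun _ => b) (fun ω => p 0 ω) θ =
        (a ^ θ * Real.log (a ^ θ / (a ^ θ + b ^ θ)) - a ^ θ
            + b ^ θ * Real.log (b ^ θ / (a ^ θ + b ^ θ)) - b ^ θ) /
          (a ^ θ * Real.log a + b ^ θ * Real.log b)) ∧
    ∃ D : ℝ → ℝ → ℝ,
      (∀ a b γ : ℝ, 0 < a → 0 < b → a + b < 1 → a = b ^ γ →
        (∀ θ : ℝ, 0 ≤ θ →
          (branchG P (fun _ => a) (fun _ => b) (fun ω => p 0 ω) θ = θ ↔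
            b ^ θ + b ^ (γ * θ) = Real.exp (-1))) ∧
        (∀ θ : ℝ, b ^ θ + b ^ (γ * θ) = Real.exp (-1) ↔ θ = D a b) ∧
        0 < D a b ∧
        ∀ᵐ ω ∂P, ∀ Φ : ℝ → ℝ, IsLargeDimensionFunction Φ →
          upperPhiDim Φ (moranMeasure (fun _ => a) (fun _ => b) (fun n => p n ω)) = D a b) ∧
      Tendsto (fun q : ℝ × ℝ => D q.1 q.2)
        (𝓝[{q : ℝ × ℝ | 0 < q.1 ∧ 0 < q.2 ∧ q.1 + q.2 < 1}] (0, 0)) (𝓝 0) ∧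
      Tendsto (fun q : ℝ × ℝ => D q.1 q.2)
        (comap Prod.fst (𝓝 1) ⊓ 𝓟 {q : ℝ × ℝ | 0 < q.1 ∧ 0 < q.2 ∧ q.1 + q.2 < 1}) atTop ∧
      Tendsto (fun q : ℝ × ℝ => D q.1 q.2)
        (comap Prod.snd (𝓝 1) ⊓ 𝓟 {q : ℝ × ℝ | 0 < q.1 ∧ 0 < q.2 ∧ q.1 + q.2 < 1}) atTop := by
  refine ⟨fun a b ha hb _ θ _ => ⟨?_, ?_, branchG_eq (hp 0) (hunif 0) ha hb θ⟩, moranDim,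
    fun a b γ ha hb hab hγ => ?_, tendsto_moranDim_nhds_zero, ?_, ?_⟩
  · exact (integral_comp_of_isUniform (hp 0) (hunif 0) (measurable_branchLogProb a b θ)
      (intervalIntegral_branchLogProb ha hb θ).1).1
  · exact (integral_comp_of_isUniform (hp 0) (hunif 0) (measurable_branchLogRatio a b θ)
      (intervalIntegral_branchLogRatio ha hb θ).1).1
  · have hpow : ∀ θ : ℝ, b ^ θ + b ^ (γ * θ) = a ^ θ + b ^ θ := fun θ => by
      rw [Real.rpow_mul hb.le, ← hγ, add_comm]
    simp only [hpow]
    exact ⟨fun θ _ => branchG_eq_self_iff (hp 0) (hunif 0) ha hb (by linarith) (by linarith) θ,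
      rpow_add_rpow_eq_iff ha hb hab, (moranDim_spec ha hb hab).1,
      ae_upperPhiDim_eq_moranDim hp hunif hindep ha hb hab⟩
  · exact tendsto_moranDim_atTop fun q h1 h2 M =>
      le_add_of_nonneg_right (Real.rpow_nonneg h2.le M)
  · exact tendsto_moranDim_atTop fun q h1 h2 M =>
      le_add_of_nonneg_left (Real.rpow_nonneg h1.le M)
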